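/- Throughout, a topos is an elementary topos (a category with finite limits, exponentials and a subobject classifier), $2 = 1+1$, an object $X$ is decidable if its diagonal $X \rightarrowtail X\times X$ is a complemented subobject, and $\mathrm{dec}(\mathcal{E})$ is the full subcategory of decidable objects of $\mathcal{E}$. An arrow $f : X \to Y$ is $\neg\neg$-dense if its image $A \rightarrowtail Y$ satisfies $\neg\neg A = Y$ in the Heyting algebra of subobjects of $Y$. Consider the following axioms on a topos $\mathcal{E}$: (NS) every object is either initial or has a global element; (DQO) for every object $X$ there is a unique (up to isomorphism under $X$) epimorphism $p_X : X \twoheadrightarrow \Pi(X)$ with $\Pi(X)$ decidable such that every arrow $X \to 2$ factors uniquely through $p_X$. Let $\mathcal{E}$ be a nondegenerate topos (that is, $0 \not\cong 1$) satisfying NS and DQO. Then for every arrow $f : X \to Y$ of $\mathcal{E}$ there is a unique arrow $\Pi(f) : \Pi(X) \to \Pi(Y)$ with $\Pi(f)\circ p_X = p_Y \circ f$, and the category $\mathrm{dec}(\mathcal{E})$ is a topos if and only if $\Pi(f)$ is an epimorphism of $\mathcal{E}$ for every $\neg\neg$-dense arrow $f$ of $\mathcal{E}$. -/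

import Mathlib

open CategoryTheory CategoryTheory.Limits

universe v u

namespace DecQuot

/-- An (elementary) topos: a category with finite limits, exponentials (every functor `X × -` has a
right adjoint) and a subobject classifier. -/
class IsTopos (C : Type u) [Category.{v} C] : Prop
    extends HasFiniteLimits C, HasSubobjectClassifier C where
  exponentiable : ∀ X : C, (prod.functor.obj X).IsLeftAdjoint

section Subobjects

variable {C : Type u} [Category.{v} C] [HasFiniteLimits C]

/-- `N` is the pseudocomplement `¬A` of `A` in the poset of subobjects of `X`. -/
def IsPseudocomplement {X : C} (A N : Subobject X) : Prop :=
  ∀ B : Subobject X, B ≤ N ↔ IsBot (B ⊓ A)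

/-- The subobject `A` has a complement: `A ⊓ B` is the least and `A ⊔ B` the greatest subobject. -/
def IsComplementedSub {X : C} (A : Subobject X) : Prop :=
  ∃ B : Subobject X, IsBot (A ⊓ B) ∧ Codisjoint A B

/-- The subobject `A` of `X` is `¬¬`-dense: `¬¬A` is all of `X`. -/
def IsDenseSub {X : C} (A : Subobject X) : Prop :=
  ∃ N : Subobject X, IsPseudocomplement A N ∧ IsPseudocomplement N ⊤

/-- `A` is the image of `f`, the least subobject of the codomain through which `f` factors. -/
def IsImageSub {X Y : C} (f : X ⟶ Y) (A : Subobject Y) : Prop :=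
  A.Factors f ∧ ∀ B : Subobject Y, B.Factors f → A ≤ B

/-- An arrow is `¬¬`-dense when its image is a `¬¬`-dense subobject of its codomain. -/
def IsDenseArrow {X Y : C} (f : X ⟶ Y) : Prop :=
  ∃ A : Subobject Y, IsImageSub f A ∧ IsDenseSub A

end Subobjects

section Axioms

variable (C : Type u) [Category.{v} C] [HasFiniteLimits C]

/-- The terminal object is not initial. -/
def Nondegenerate : Prop := ¬ Nonempty (IsInitial (⊤_ C))

/-- Every object is either initial or has a global element. -/
def NS : Prop := ∀ X : C, Nonempty (IsInitial X) ∨ Nonempty (⊤_ C ⟶ X)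

/-- An object is decidable when its diagonal is a complemented subobject of `X ⨯ X`. -/
def decidableObj : ObjectProperty C := fun X => IsComplementedSub (Subobject.mk (diag X))

/-- The full subcategory of decidable objects. -/
abbrev Dec : Type u := (decidableObj C).FullSubcategory

variable {C}

/-- `p : X ⟶ Q` is a decidable quotient along which every arrow from `X` to `2 = 1 + 1` factors
uniquely. -/
structure IsDecidableQuotient {X Q : C} (p : X ⟶ Q) : Prop where
  decidable : decidableObj C Q
  epi : Epi p
  factors : ∀ two : BinaryCofan (⊤_ C) (⊤_ C), IsColimit two →
    ∀ f : X ⟶ two.pt, ∃! g : Q ⟶ two.pt, p ≫ g = f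

variable (C)

/-- Every object has a decidable quotient along which every arrow to `2` factors uniquely, and this
quotient is unique (as a quotient object, i.e. up to isomorphism under `X`). -/
def DQO : Prop :=
  ∀ X : C, (∃ (Q : C) (p : X ⟶ Q), IsDecidableQuotient p) ∧
    ∀ (Q Q' : C) (p : X ⟶ Q) (p' : X ⟶ Q'), IsDecidableQuotient p → IsDecidableQuotient p' →
      ∃ e : Q ≅ Q', p ≫ e.hom = p'

variable {C}

/-- The object `Π(X)`: the decidable quotient of `X` provided by `DQO`. -/
noncomputable def Pi (h : DQO C) (X : C) : C := (h X).1.choose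

/-- The quotient map `p_X : X ⟶ Π(X)`. -/
noncomputable def piProj (h : DQO C) (X : C) : X ⟶ Pi h X := (h X).1.choose_spec.choose

theorem isDecidableQuotient_piProj (h : DQO C) (X : C) : IsDecidableQuotient (piProj h X) :=
  (h X).1.choose_spec.choose_spec

/-- `g` is the arrow `Π(f) : Π(X) ⟶ Π(Y)`, i.e. `g ∘ p_X = p_Y ∘ f`. -/
def IsPiMap (h : DQO C) {X Y : C} (f : X ⟶ Y) (g : Pi h X ⟶ Pi h Y) : Prop :=
  piProj h X ≫ g = f ≫ piProj h Y

end Axioms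

end DecQuot

/-! Both sides of the equivalence amount to one condition: every subobject of a decidable object is
complemented. NS makes global elements decisive. A subobject is least iff it has no points, a
complemented subobject containing every point is everything, and the dense subobjects are exactly
those containing every point. DQO makes `piProj` universal among maps to decidable objects
(`exists_factor_piProj`), which gives `Π` on arrows and makes `p_D` invertible for decidable `D`.

If the decidable objects form a topos, its classifier is decidable in `C`, so a subobject of a
decidable object is an equalizer of maps into a decidable object and hence complemented. For dense
`f`, two maps that agree after `Π(f)` have a complemented equalizer in `Π(Y)`. It contains every
point, because points lift along `p_Y`; so the maps are equal.

Conversely, for `A` in a decidable `D`, any subobject `B` above `A` and `¬A` contains all points, so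
its inclusion is dense. Since `Π(D) ≅ D`, surjectivity of `Π` makes `B` everything, that is, `A` is
complemented. Truth values in `{true, false}` then classify decidable subobjects. Exponentials of
decidable objects are decidable by DQO and NS alone (`decidable_expObj`), and finite limits are
inherited. -/

namespace DecQuot

/-! ### Internal logic of a topos via generalized elements; unions and images are obtained
impredicatively. -/

section Logic

variable {C : Type u} [Category.{v} C]

theorem pullback_factors [HasPullbacks C] {X Y T : C} (f : X ⟶ Y) (A : Subobject Y) (t : T ⟶ X) :
    ((Subobject.pullback f).obj A).Factors t ↔ A.Factors (t ≫ f) := by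
  have h := Subobject.isPullback f A
  constructor
  · intro ht
    refine (Subobject.factors_iff _ _).2 ⟨Subobject.factorThru _ t ht ≫ Subobject.pullbackπ f A, ?_⟩
    change (_ ≫ _) ≫ A.arrow = _
    rw [Category.assoc, h.w, Subobject.factorThru_arrow_assoc]
  · intro ht
    refine (Subobject.factors_iff _ _).2 ⟨h.lift (A.factorThru _ ht) t (by simp), ?_⟩
    exact h.lift_snd _ _ _

theorem mk_factors {X Y T : C} (f : X ⟶ Y) [Mono f] (t : T ⟶ Y) :
    (Subobject.mk f).Factors t ↔ ∃ k : T ⟶ X, k ≫ f = t :=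
  Subobject.mk_factors_iff f t

theorem mk_equalizer_factors [HasEqualizers C] {X Y T : C} (u v : X ⟶ Y) (t : T ⟶ X) :
    (Subobject.mk (equalizer.ι u v)).Factors t ↔ t ≫ u = t ≫ v := by
  rw [mk_factors]
  constructor
  · rintro ⟨k, hk⟩
    rw [← hk, Category.assoc, Category.assoc, equalizer.condition]
  · intro h
    exact ⟨equalizer.lift t h, equalizer.lift_ι t h⟩

theorem subobject_eq_top {X : C} {A : Subobject X} (h : A.Factors (𝟙 X)) : A = ⊤ :=
  top_le_iff.1 (Subobject.le_of_factors (by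
    have := Subobject.factors_of_factors_right (⊤ : Subobject X).arrow h
    rwa [Category.comp_id] at this))

theorem factors_precomp {X T S : C} {A : Subobject X} {t : T ⟶ X} (h : A.Factors t) (s : S ⟶ T) :
    A.Factors (s ≫ t) := Subobject.factors_of_factors_right s h

theorem mk_diag_factors [HasBinaryProducts C] {X T : C} (t : T ⟶ X ⨯ X) :
    (Subobject.mk (diag X)).Factors t ↔ t ≫ prod.fst = t ≫ prod.snd := by
  rw [mk_factors]
  constructor
  · rintro ⟨k, rfl⟩
    rw [Category.assoc, Category.assoc, prod.lift_fst, prod.lift_snd]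
  · intro h
    refine ⟨t ≫ prod.fst, ?_⟩
    ext
    · rw [Category.assoc, prod.lift_fst, Category.comp_id]
    · rw [Category.assoc, prod.lift_snd, Category.comp_id, h]

section Classifier

variable [HasSubobjectClassifier C]

/-- The constantly true map. -/
noncomputable def constTrue (T : C) : T ⟶ HasSubobjectClassifier.Ω C :=
  Subobject.Classifier.χ₀ _ T ≫ HasSubobjectClassifier.truth C

@[simp]
theorem comp_constTrue {S T : C} (s : S ⟶ T) : s ≫ constTrue T = constTrue S := by
  unfold constTrue
  rw [← Category.assoc]
  congr 1
  exact Subsingleton.elim _ _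

theorem mk_truth_factors {T : C} (t : T ⟶ HasSubobjectClassifier.Ω C) :
    (Subobject.mk (HasSubobjectClassifier.truth C)).Factors t ↔ t = constTrue T := by
  rw [mk_factors]
  constructor
  · rintro ⟨k, hk⟩
    rw [← hk]
    unfold constTrue
    congr 1
    exact Subsingleton.elim _ _
  · intro h
    exact ⟨_, h.symm⟩

/-- The characteristic map of a subobject. -/
noncomputable def char {X : C} (A : Subobject X) : X ⟶ HasSubobjectClassifier.Ω C :=
  HasSubobjectClassifier.χ A.arrow

theorem factors_iff_char {X T : C} (A : Subobject X) (t : T ⟶ X) :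
    A.Factors t ↔ t ≫ char A = constTrue T := by
  have h := HasSubobjectClassifier.isPullback_χ A.arrow
  constructor
  · intro ht
    rw [← A.factorThru_arrow t ht, Category.assoc]
    unfold char
    rw [h.w]
    exact comp_constTrue (A.factorThru t ht)
  · intro ht
    refine (Subobject.factors_iff _ _).2 ⟨h.lift t _ ht, ?_⟩
    exact h.lift_fst _ _ _

variable [HasFiniteLimits C]

theorem char_ext {X : C} {u v : X ⟶ HasSubobjectClassifier.Ω C}
    (h : ∀ {T : C} (t : T ⟶ X), t ≫ u = constTrue T ↔ t ≫ v = constTrue T) : u = v := by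
  have key : ∀ {u v : X ⟶ HasSubobjectClassifier.Ω C},
      (∀ {T : C} (t : T ⟶ X), t ≫ u = constTrue T → t ≫ v = constTrue T) →
      (Subobject.pullback u).obj (Subobject.mk (HasSubobjectClassifier.truth C)) ≤
        (Subobject.pullback v).obj (Subobject.mk (HasSubobjectClassifier.truth C)) := by
    intro u v h
    apply Subobject.le_of_factors
    rw [pullback_factors, mk_truth_factors]
    apply h
    rw [← mk_truth_factors, ← pullback_factors]
    exact Subobject.factors_self _
  have huv : (Subobject.pullback u).obj (Subobject.mk (HasSubobjectClassifier.truth C)) =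
      (Subobject.pullback v).obj (Subobject.mk (HasSubobjectClassifier.truth C)) :=
    le_antisymm (key fun t => (h t).1) (key fun t => (h t).2)
  exact (HasSubobjectClassifier.exists_classifier (C := C)).some.representableBy.homEquiv.injective
    huv

theorem char_comp_eq_iff {X T : C} (A B : Subobject X) (t : T ⟶ X) :
    t ≫ char A = t ≫ char B ↔
      ∀ {S : C} (s : S ⟶ T), A.Factors (s ≫ t) ↔ B.Factors (s ≫ t) := by
  constructor
  · intro h S s
    rw [factors_iff_char, factors_iff_char, Category.assoc, Category.assoc, h]
  · intro h
    apply char_ext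
    intro S s
    rw [← Category.assoc, ← Category.assoc, ← factors_iff_char, ← factors_iff_char]
    exact h s

/-- `A ⇒ B` is where `A` and `A ⊓ B` have the same truth value. -/
theorem exists_implication {X : C} (A B : Subobject X) :
    ∃ I : Subobject X, ∀ {T : C} (t : T ⟶ X), I.Factors t ↔
      ∀ {S : C} (s : S ⟶ T), A.Factors (s ≫ t) → B.Factors (s ≫ t) := by
  refine ⟨Subobject.mk (equalizer.ι (char A) (char (A ⊓ B))), fun t => ?_⟩
  rw [mk_equalizer_factors, char_comp_eq_iff]
  constructor
  · intro h S s hs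
    exact ((Subobject.inf_factors _).1 ((h s).1 hs)).2
  · intro h S s
    rw [Subobject.inf_factors]
    exact ⟨fun hs => ⟨hs, h s hs⟩, fun hs => hs.1⟩

end Classifier

section Topos

variable [IsTopos C]

instance prodFunctor_isLeftAdjoint (X : C) : (prod.functor.obj X).IsLeftAdjoint :=
  IsTopos.exponentiable X

/-- The exponential `Z ^ X`. -/
noncomputable def expObj (X Z : C) : C := (prod.functor.obj X).rightAdjoint.obj Z

/-- Evaluation. -/
noncomputable def expEv (X Z : C) : X ⨯ expObj X Z ⟶ Z :=
  (Adjunction.ofIsLeftAdjoint (prod.functor.obj X)).counit.app Z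

/-- The exponential transpose of a map. -/
noncomputable def expCurry {X Y Z : C} (f : X ⨯ Y ⟶ Z) : Y ⟶ expObj X Z :=
  (Adjunction.ofIsLeftAdjoint (prod.functor.obj X)).homEquiv Y Z f

theorem map_expCurry_ev {X Y Z : C} (f : X ⨯ Y ⟶ Z) :
    prod.map (𝟙 X) (expCurry f) ≫ expEv X Z = f := by
  have h := ((Adjunction.ofIsLeftAdjoint (prod.functor.obj X)).homEquiv Y Z).symm_apply_apply f
  rw [Adjunction.homEquiv_counit] at h
  exact h

theorem exp_hom_ext {X Y Z : C} {g h : Y ⟶ expObj X Z}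
    (w : prod.map (𝟙 X) g ≫ expEv X Z = prod.map (𝟙 X) h ≫ expEv X Z) : g = h := by
  let adj := Adjunction.ofIsLeftAdjoint (prod.functor.obj X)
  have key : ∀ g : Y ⟶ (prod.functor.obj X).rightAdjoint.obj Z,
      (adj.homEquiv Y Z).symm g = (prod.functor.obj X).map g ≫ adj.counit.app Z :=
    fun g => adj.homEquiv_counit _ _ g
  exact (adj.homEquiv Y Z).symm.injective ((key g).trans (w.trans (key h).symm))

theorem comp_expCurry_eq_iff {X Y Z T : C} (f g : X ⨯ Y ⟶ Z) (t : T ⟶ Y) :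
    t ≫ expCurry f = t ≫ expCurry g ↔ prod.map (𝟙 X) t ≫ f = prod.map (𝟙 X) t ≫ g := by
  have key : ∀ f : X ⨯ Y ⟶ Z,
      prod.map (𝟙 X) (t ≫ expCurry f) ≫ expEv X Z = prod.map (𝟙 X) t ≫ f := by
    intro f
    rw [prod.map_id_comp, Category.assoc, map_expCurry_ev]
  constructor
  · intro h
    rw [← key, ← key, h]
  · intro h
    apply exp_hom_ext
    rw [key, key, h]

/-- Universal quantification over `X`: the locus where the transposed characteristic map of `A`
equals the transpose of constant truth. -/
theorem exists_forall_proj {X Y : C} (A : Subobject (X ⨯ Y)) :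
    ∃ D : Subobject Y, ∀ {T : C} (t : T ⟶ Y), D.Factors t ↔ A.Factors (prod.map (𝟙 X) t) := by
  refine ⟨Subobject.mk (equalizer.ι (expCurry (char A)) (expCurry (constTrue (X ⨯ Y)))),
    fun {T} t => ?_⟩
  rw [mk_equalizer_factors, comp_expCurry_eq_iff, factors_iff_char, comp_constTrue]

/-- Quantifies the implication `f y = x ⇒ y ∈ A` over `y`, giving a right adjoint to pullback along
`f`. -/
theorem exists_forall {X Y : C} (f : Y ⟶ X) (A : Subobject Y) :
    ∃ D : Subobject X, ∀ {S : C} (s : S ⟶ X), D.Factors s ↔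
      ∀ {T : C} (t : T ⟶ Y) (r : T ⟶ S), t ≫ f = r ≫ s → A.Factors t := by
  obtain ⟨I, hI⟩ := exists_implication
    (Subobject.mk (equalizer.ι (prod.fst ≫ f : Y ⨯ X ⟶ X) prod.snd))
    ((Subobject.pullback prod.fst).obj A)
  obtain ⟨D, hD⟩ := exists_forall_proj I
  refine ⟨D, fun {S} s => ?_⟩
  rw [hD, hI]
  constructor
  · intro h T t r htr
    have := h (prod.lift t r)
    rw [mk_equalizer_factors, pullback_factors] at this
    simpa [htr, prod.lift_fst, prod.lift_snd, prod.lift_fst_assoc, prod.lift_snd_assoc] using this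
  · intro h T w
    rw [mk_equalizer_factors, pullback_factors]
    intro hw
    have := h (w ≫ prod.fst) (w ≫ prod.snd) (by simpa using hw)
    simpa using this

/-- Reasoning by cases along a pair of codisjoint subobjects. -/
theorem factors_of_codisjoint {X Y Z : C} {A B : Subobject X} (hAB : Codisjoint A B)
    (D : Subobject Z) (f : Y ⟶ X) (g : Y ⟶ Z)
    (hA : ∀ {T : C} (t : T ⟶ Y), A.Factors (t ≫ f) → D.Factors (t ≫ g))
    (hB : ∀ {T : C} (t : T ⟶ Y), B.Factors (t ≫ f) → D.Factors (t ≫ g)) : D.Factors g := by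
  -- `F = ∀_f (g^* D)` turns the two cases over `Y` into inclusions in `X`, where codisjointness
  -- applies: pullback preserves unions.
  obtain ⟨F, hF⟩ := exists_forall f ((Subobject.pullback g).obj D)
  have key : ∀ A : Subobject X, (∀ {T : C} (t : T ⟶ Y), A.Factors (t ≫ f) → D.Factors (t ≫ g)) →
      A ≤ F := by
    intro A hA
    apply Subobject.le_of_factors
    rw [hF]
    intro T t r htr
    rw [pullback_factors]
    apply hA
    rw [htr]
    exact Subobject.factors_comp_arrow _
  have hF' : F.Factors (𝟙 X) :=
    Subobject.factors_of_le _ (hAB (key A hA) (key B hB)) (Subobject.top_factors _)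
  have := (hF _).1 hF' (𝟙 Y) f (by simp)
  rw [pullback_factors] at this
  simpa using this

/-- There is a power object with a membership relation naming every subobject. -/
theorem exists_power (Y : C) : ∃ (P : C) (mem : Subobject (Y ⨯ P)), ∀ B : Subobject Y,
    ∃ b : ⊤_ C ⟶ P, ∀ {T : C} (t : T ⟶ Y),
      mem.Factors (prod.lift t (terminal.from T ≫ b)) ↔ B.Factors t := by
  refine ⟨expObj Y (HasSubobjectClassifier.Ω C), (Subobject.pullback (expEv Y _)).obj
    (Subobject.mk (HasSubobjectClassifier.truth C)), fun B => ?_⟩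
  refine ⟨expCurry (prod.fst ≫ char B), fun {T} t => ?_⟩
  rw [pullback_factors, mk_truth_factors, factors_iff_char]
  have h2 : prod.lift t (terminal.from T ≫ expCurry (prod.fst ≫ char B)) =
      prod.lift t (terminal.from T) ≫ prod.map (𝟙 Y) (expCurry (prod.fst ≫ char B)) := by
    simp
  rw [h2, Category.assoc, map_expCurry_ev, prod.lift_fst_assoc]

/-- Any two maps with the same codomain have a joint image. -/
theorem exists_joint_image {X X' Y : C} (f : X ⟶ Y) (f' : X' ⟶ Y) :
    ∃ A : Subobject Y, A.Factors f ∧ A.Factors f' ∧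
      ∀ B : Subobject Y, B.Factors f → B.Factors f' → A ≤ B := by
  obtain ⟨P, mem, hmem⟩ := exists_power Y
  obtain ⟨F₁, hF₁⟩ := exists_forall_proj ((Subobject.pullback (prod.map f (𝟙 P))).obj mem)
  obtain ⟨F₂, hF₂⟩ := exists_forall_proj ((Subobject.pullback (prod.map f' (𝟙 P))).obj mem)
  -- `F` consists of the names of subobjects through which both maps factor; `A` below is their
  -- internal intersection.
  let F := F₁ ⊓ F₂
  obtain ⟨A, hA⟩ := exists_forall_proj
    ((Subobject.pullback (prod.lift prod.snd (prod.fst ≫ F.arrow))).obj mem :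
      Subobject ((F : C) ⨯ Y))
  have hF := (Subobject.inf_factors _).1 (Subobject.factors_self F)
  have aux : ∀ {X : C} (f : X ⟶ Y) {F' : Subobject P} (hF' : ∀ {T : C} (t : T ⟶ P),
      F'.Factors t ↔ ((Subobject.pullback (prod.map f (𝟙 P))).obj mem).Factors
        (prod.map (𝟙 X) t)), F'.Factors F.arrow → A.Factors f := by
    intro X f F' hF' h
    rw [hF', pullback_factors] at h
    rw [hA, pullback_factors]
    have := factors_precomp h (prod.lift prod.snd prod.fst : (F : C) ⨯ X ⟶ X ⨯ (F : C))
    simpa using this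
  refine ⟨A, aux f hF₁ hF.1, aux f' hF₂ hF.2, fun B hB hB' => ?_⟩
  obtain ⟨b, hb⟩ := hmem B
  have aux' : ∀ {X : C} (f : X ⟶ Y) {F' : Subobject P} (hF' : ∀ {T : C} (t : T ⟶ P),
      F'.Factors t ↔ ((Subobject.pullback (prod.map f (𝟙 P))).obj mem).Factors
        (prod.map (𝟙 X) t)), B.Factors f → F'.Factors b := by
    intro X f F' hF' h
    rw [hF', pullback_factors]
    have h2 : prod.map (𝟙 X) b ≫ prod.map f (𝟙 P) =
        prod.lift (prod.fst ≫ f) (terminal.from _ ≫ b) := by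
      ext
      · simp [prod.lift_fst]
      · simp [Subsingleton.elim (terminal.from (X ⨯ ⊤_ C)) prod.snd]
    rw [h2, hb]
    exact factors_precomp h _
  have hbF : F.Factors b := (Subobject.inf_factors _).2 ⟨aux' f hF₁ hB, aux' f' hF₂ hB'⟩
  apply Subobject.le_of_factors
  have h := (hA _).1 (Subobject.factors_self A)
  rw [pullback_factors] at h
  have h2 := factors_precomp h (prod.lift (terminal.from (A : C) ≫ F.factorThru b hbF) (𝟙 (A : C)))
  rw [← hb]
  simpa [prod.lift_fst, prod.lift_snd, prod.lift_fst_assoc, prod.lift_snd_assoc] using h2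

/-- Every map factors as an epimorphism followed by a monomorphism. -/
theorem exists_epi_factorization {X Y : C} (f : X ⟶ Y) :
    ∃ (A : Subobject Y) (e : X ⟶ (A : C)), Epi e ∧ e ≫ A.arrow = f := by
  obtain ⟨A, hA, -, hmin⟩ := exists_joint_image f f
  refine ⟨A, A.factorThru f hA, ⟨fun {Z} u v huv => ?_⟩, A.factorThru_arrow f hA⟩
  -- The equalizer of `u` and `v` also contains the image of `f`, so by minimality of `A` it is all
  -- of `A`.
  have hB : (Subobject.mk (equalizer.ι u v ≫ A.arrow)).Factors f := by
    rw [mk_factors]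
    refine ⟨equalizer.lift _ huv, ?_⟩
    rw [equalizer.lift_ι_assoc, A.factorThru_arrow]
  have h := Subobject.factors_of_le _ (hmin _ hB hB) (Subobject.factors_self A)
  rw [mk_factors] at h
  obtain ⟨k, hk⟩ := h
  have hk' : k ≫ equalizer.ι u v = 𝟙 _ := by
    rw [← cancel_mono A.arrow, Category.assoc, hk, Category.id_comp]
  rw [← Category.id_comp u, ← Category.id_comp v, ← hk', Category.assoc, Category.assoc,
    equalizer.condition]

end Topos

end Logic

/-! ### Consequences of NS: points, complements and decidable objects. -/

section Points

variable {C : Type u} [Category.{v} C] [IsTopos C]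

theorem isInitial_of_isEmpty_points (hNS : NS C) {X : C} (hX : IsEmpty (⊤_ C ⟶ X)) :
    Nonempty (IsInitial X) :=
  (hNS X).resolve_right (not_nonempty_iff.2 hX)

theorem factors_of_isEmpty_points (hNS : NS C) {T X : C} (hT : IsEmpty (⊤_ C ⟶ T))
    (A : Subobject X) (t : T ⟶ X) : A.Factors t := by
  obtain ⟨i⟩ := isInitial_of_isEmpty_points hNS hT
  exact (Subobject.factors_iff _ _).2 ⟨i.to _, i.hom_ext _ _⟩

/-- If every object had a point, so would every equalizer of two points; all parallel points would
coincide and `1` would be initial. -/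
theorem exists_isEmpty_points (hnd : Nondegenerate C) : ∃ X : C, IsEmpty (⊤_ C ⟶ X) := by
  by_contra! h
  refine hnd ⟨IsInitial.ofUniqueHom (fun X => (h X).some) fun X m => ?_⟩
  obtain ⟨k⟩ := h (equalizer m (h X).some)
  have hk : k ≫ equalizer.ι m (h X).some = 𝟙 _ := Subsingleton.elim _ _
  rw [← Category.id_comp m, ← hk, Category.assoc, equalizer.condition, ← Category.assoc, hk,
    Category.id_comp]

theorem exists_subobject_without_points (hnd : Nondegenerate C) (hNS : NS C) (X : C) :
    ∃ O : Subobject X, ∀ x : ⊤_ C ⟶ X, ¬ O.Factors x := by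
  obtain ⟨Z, hZ⟩ := exists_isEmpty_points hnd
  obtain ⟨i⟩ := isInitial_of_isEmpty_points hNS hZ
  have : Mono (i.to X) := ⟨fun {W} u v _ => by
    have hW : IsEmpty (⊤_ C ⟶ W) := ⟨fun w => hZ.false (w ≫ u)⟩
    obtain ⟨j⟩ := isInitial_of_isEmpty_points hNS hW
    exact j.hom_ext _ _⟩
  refine ⟨Subobject.mk (i.to X), fun x hx => ?_⟩
  rw [mk_factors] at hx
  exact hZ.false hx.choose

theorem isBot_iff (hnd : Nondegenerate C) (hNS : NS C) {X : C} (A : Subobject X) :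
    IsBot A ↔ ∀ x : ⊤_ C ⟶ X, ¬ A.Factors x := by
  constructor
  · intro hA x hx
    obtain ⟨O, hO⟩ := exists_subobject_without_points hnd hNS X
    exact hO x (Subobject.factors_of_le _ (hA O) hx)
  · intro hA B
    exact Subobject.le_of_factors (factors_of_isEmpty_points hNS
      ⟨fun x => hA _ (Subobject.factors_comp_arrow x)⟩ _ _)

/-- Falsity holds exactly at stages without points, since these are initial; hence negation is
tested on points only. -/
theorem exists_not (hnd : Nondegenerate C) (hNS : NS C) {X : C} (A : Subobject X) :
    ∃ N : Subobject X, ∀ {T : C} (t : T ⟶ X),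
      N.Factors t ↔ ∀ x : ⊤_ C ⟶ T, ¬ A.Factors (x ≫ t) := by
  obtain ⟨O, hO⟩ := exists_subobject_without_points hnd hNS X
  obtain ⟨N, hN⟩ := exists_implication A O
  refine ⟨N, fun {T} t => ?_⟩
  rw [hN]
  constructor
  · intro h x hx
    exact hO _ (h x hx)
  · intro h S s hs
    refine factors_of_isEmpty_points hNS ⟨fun x => h (x ≫ s) ?_⟩ _ _
    rw [Category.assoc]
    exact factors_precomp hs x

/-- Second-order form of `A ∨ ¬A`: everything above both `A` and `¬A` is the whole object, so no
union has to be constructed. -/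
theorem isComplementedSub_of (hnd : Nondegenerate C) (hNS : NS C) {X : C} {A : Subobject X}
    (h : ∀ D : Subobject X, A ≤ D →
      (∀ {T : C} (t : T ⟶ X), (∀ x : ⊤_ C ⟶ T, ¬ A.Factors (x ≫ t)) → D.Factors t) →
      D.Factors (𝟙 X)) : IsComplementedSub A := by
  obtain ⟨N, hN⟩ := exists_not hnd hNS A
  refine ⟨N, (isBot_iff hnd hNS _).2 fun x hx => ?_, fun D hA hD => ?_⟩
  · rw [Subobject.inf_factors] at hx
    exact (hN x).1 hx.2 (𝟙 _) (by simpa using hx.1)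
  · rw [subobject_eq_top (h D hA fun t ht => Subobject.factors_of_le _ hD ((hN t).2 ht))]

theorem IsComplementedSub.cases (hnd : Nondegenerate C) (hNS : NS C) {X Y Z : C}
    {A : Subobject X} (hA : IsComplementedSub A) (D : Subobject Z) (f : Y ⟶ X) (g : Y ⟶ Z)
    (h₁ : ∀ {T : C} (t : T ⟶ Y), A.Factors (t ≫ f) → D.Factors (t ≫ g))
    (h₂ : ∀ {T : C} (t : T ⟶ Y), (∀ x : ⊤_ C ⟶ T, ¬ A.Factors (x ≫ t ≫ f)) →
      D.Factors (t ≫ g)) : D.Factors g := by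
  obtain ⟨B, hB, hAB⟩ := hA
  refine factors_of_codisjoint hAB D f g h₁ fun t ht => h₂ t fun x hx => ?_
  exact (isBot_iff hnd hNS _).1 hB _ ((Subobject.inf_factors _).2 ⟨hx, factors_precomp ht x⟩)

theorem IsComplementedSub.of_iff (hnd : Nondegenerate C) (hNS : NS C) {X Y : C}
    {A : Subobject X} (hA : IsComplementedSub A) (f : Y ⟶ X) {B : Subobject Y}
    (h : ∀ {T : C} (t : T ⟶ Y), B.Factors t ↔ A.Factors (t ≫ f)) : IsComplementedSub B := by
  refine isComplementedSub_of hnd hNS fun D hD hD' => ?_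
  refine hA.cases hnd hNS D f (𝟙 Y) (fun t ht => ?_) fun t ht => ?_
  · rw [Category.comp_id]
    exact Subobject.factors_of_le _ hD ((h t).2 ht)
  · rw [Category.comp_id]
    refine hD' t fun x => ?_
    rw [h, Category.assoc]
    exact ht x

theorem IsComplementedSub.inf (hnd : Nondegenerate C) (hNS : NS C) {X : C}
    {A B : Subobject X} (hA : IsComplementedSub A) (hB : IsComplementedSub B) :
    IsComplementedSub (A ⊓ B) := by
  refine isComplementedSub_of hnd hNS fun D hD hD' => ?_
  refine hA.cases hnd hNS D (𝟙 X) (𝟙 X) (fun t ht => ?_) fun t ht => ?_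
  · rw [Category.comp_id] at ht ⊢
    refine hB.cases hnd hNS D t t (fun s hs => ?_) fun s hs => ?_
    · exact Subobject.factors_of_le _ hD ((Subobject.inf_factors _).2 ⟨factors_precomp ht s, hs⟩)
    · refine hD' _ fun x hx => hs x ((Subobject.inf_factors _).1 hx).2
  · rw [Category.comp_id] at ht ⊢
    exact hD' _ fun x hx => ht x ((Subobject.inf_factors _).1 hx).1

/-- The part of `Y` lying over the complement has no points, hence is initial. -/
theorem IsComplementedSub.factors_of_points (hnd : Nondegenerate C) (hNS : NS C) {X Y : C}
    {A : Subobject X} (hA : IsComplementedSub A) (f : Y ⟶ X)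
    (h : ∀ x : ⊤_ C ⟶ Y, A.Factors (x ≫ f)) : A.Factors f := by
  refine hA.cases hnd hNS A f f (fun t ht => ht) fun t ht => ?_
  refine factors_of_isEmpty_points hNS ⟨fun x => ht x ?_⟩ _ _
  rw [← Category.assoc]
  exact h _

theorem decidable_hom_ext (hnd : Nondegenerate C) (hNS : NS C) {T D : C}
    (hD : decidableObj C D) {u v : T ⟶ D} (h : ∀ x : ⊤_ C ⟶ T, x ≫ u = x ≫ v) : u = v := by
  have := IsComplementedSub.factors_of_points hnd hNS hD (prod.lift u v) fun x => by
    rw [mk_diag_factors]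
    simpa [prod.lift_fst, prod.lift_snd] using h x
  rw [mk_diag_factors, prod.lift_fst, prod.lift_snd] at this
  exact this

theorem decidable_of_mono (hnd : Nondegenerate C) (hNS : NS C) {A D : C} (m : A ⟶ D) [Mono m]
    (hD : decidableObj C D) : decidableObj C A := by
  refine IsComplementedSub.of_iff hnd hNS hD (prod.map m m) fun t => ?_
  rw [mk_diag_factors, mk_diag_factors, Category.assoc, Category.assoc, prod.map_fst,
    prod.map_snd, ← Category.assoc, ← Category.assoc, cancel_mono]

theorem decidable_prod (hnd : Nondegenerate C) (hNS : NS C) {X Y : C}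
    (hX : decidableObj C X) (hY : decidableObj C Y) : decidableObj C (X ⨯ Y) := by
  have hX' : IsComplementedSub ((Subobject.pullback
      (prod.map prod.fst prod.fst : (X ⨯ Y) ⨯ (X ⨯ Y) ⟶ X ⨯ X)).obj (Subobject.mk (diag X))) :=
    IsComplementedSub.of_iff hnd hNS hX _ (pullback_factors _ _)
  have hY' : IsComplementedSub ((Subobject.pullback
      (prod.map prod.snd prod.snd : (X ⨯ Y) ⨯ (X ⨯ Y) ⟶ Y ⨯ Y)).obj (Subobject.mk (diag Y))) :=
    IsComplementedSub.of_iff hnd hNS hY _ (pullback_factors _ _)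
  refine (hX'.inf hnd hNS hY').of_iff hnd hNS (𝟙 _) fun t => ?_
  rw [Category.comp_id, Subobject.inf_factors, pullback_factors, pullback_factors,
    mk_diag_factors, mk_diag_factors, mk_diag_factors]
  constructor
  · intro h
    simp [reassoc_of% h]
  · rintro ⟨h₁, h₂⟩
    ext
    · simpa using h₁
    · simpa using h₂

theorem decidable_of_subsingleton (hnd : Nondegenerate C) (hNS : NS C) {X : C}
    (hX : ∀ {T : C} (u v : T ⟶ X), u = v) : decidableObj C X :=
  isComplementedSub_of hnd hNS fun _ hD _ =>
    Subobject.factors_of_le _ hD ((mk_diag_factors _).2 (hX _ _))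

theorem mk_point_factors {X T : C} (q : ⊤_ C ⟶ X) (t : T ⟶ X) :
    (Subobject.mk q).Factors t ↔ t = terminal.from T ≫ q := by
  rw [mk_factors]
  constructor
  · rintro ⟨k, rfl⟩
    rw [Subsingleton.elim k]
  · rintro rfl
    exact ⟨_, rfl⟩

theorem isComplementedSub_point (hnd : Nondegenerate C) (hNS : NS C) {D : C}
    (hD : decidableObj C D) (q : ⊤_ C ⟶ D) : IsComplementedSub (Subobject.mk q) := by
  refine IsComplementedSub.of_iff hnd hNS hD (prod.lift (𝟙 D) (terminal.from D ≫ q)) fun t => ?_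
  rw [mk_diag_factors, mk_point_factors]
  simp [prod.lift_fst, prod.lift_snd]

/-- If `q` had no lift, `p` would factor through the complement of `{q}`, which would then be all of
`D`. -/
theorem exists_point_lift (hnd : Nondegenerate C) (hNS : NS C) {Y D : C} (p : Y ⟶ D) [Epi p]
    (hD : decidableObj C D) (q : ⊤_ C ⟶ D) : ∃ y : ⊤_ C ⟶ Y, y ≫ p = q := by
  by_contra! hq
  obtain ⟨N, hN⟩ := exists_not hnd hNS (Subobject.mk q)
  have hp : N.Factors p := by
    refine (isComplementedSub_point hnd hNS hD q).cases hnd hNS N p p (fun t ht => ?_) fun t ht => ?_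
    · refine factors_of_isEmpty_points hNS ⟨fun x => hq (x ≫ t) ?_⟩ _ _
      rw [mk_point_factors] at ht
      rw [Category.assoc, ht, ← Category.assoc, Subsingleton.elim (x ≫ _) (𝟙 _), Category.id_comp]
    · exact (hN _).2 ht
  have : Epi N.arrow := epi_of_epi_fac (N.factorThru_arrow p hp)
  have : IsIso N.arrow := isIso_of_mono_of_epi _
  have hNq : N.Factors q := by
    rw [Subobject.eq_top_of_isIso_arrow N]
    exact Subobject.top_factors _
  refine (hN q).1 hNq (𝟙 _) ?_
  rw [Category.id_comp, mk_factors]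
  exact ⟨𝟙 _, Category.id_comp _⟩

end Points

/-! ### Universality of the decidable quotient, and exponentials. -/

section Quotient

variable {C : Type u} [Category.{v} C] [IsTopos C]

/-- The image of `(p_X, g)` in `Π(X) ⨯ D` is another decidable quotient of `X` with the
factorization property. The uniqueness clause of DQO identifies it with `Π(X)`, and the second
projection is the factorization of `g`. -/
theorem exists_factor_piProj (hnd : Nondegenerate C) (hNS : NS C) (h : DQO C) {X D : C}
    (hD : decidableObj C D) (g : X ⟶ D) : ∃ k : Pi h X ⟶ D, piProj h X ≫ k = g := by
  have hp := isDecidableQuotient_piProj h X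
  obtain ⟨A, e, he, hA⟩ := exists_epi_factorization (prod.lift (piProj h X) g)
  have hA₁ : e ≫ A.arrow ≫ prod.fst = piProj h X := by
    rw [← Category.assoc, hA, prod.lift_fst]
  have hq : IsDecidableQuotient e :=
    { decidable := decidable_of_mono hnd hNS A.arrow (decidable_prod hnd hNS hp.decidable hD)
      epi := he
      factors := fun two htwo f => by
        obtain ⟨k, hk, -⟩ := hp.factors two htwo f
        refine ⟨A.arrow ≫ prod.fst ≫ k, ?_, fun k' hk' => ?_⟩
        · change e ≫ A.arrow ≫ prod.fst ≫ k = f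
          rw [← hk, ← hA₁]
          simp
        · rw [← cancel_epi e, hk', ← hk, ← hA₁]
          simp }
  obtain ⟨i, hi⟩ := (h X).2 _ _ _ _ hp hq
  refine ⟨i.hom ≫ A.arrow ≫ prod.snd, ?_⟩
  rw [← Category.assoc, hi, ← Category.assoc, hA, prod.lift_snd]

theorem existsUnique_piMap (hnd : Nondegenerate C) (hNS : NS C) (h : DQO C) {X Y : C}
    (f : X ⟶ Y) : ∃! g : Pi h X ⟶ Pi h Y, IsPiMap h f g := by
  obtain ⟨g, hg⟩ := exists_factor_piProj hnd hNS h (isDecidableQuotient_piProj h Y).decidable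
    (f ≫ piProj h Y)
  have := (isDecidableQuotient_piProj h X).epi
  refine ⟨g, hg, fun g' hg' => ?_⟩
  rw [← cancel_epi (piProj h X), hg]
  exact hg'

theorem isIso_piProj (hnd : Nondegenerate C) (hNS : NS C) (h : DQO C) {D : C}
    (hD : decidableObj C D) : IsIso (piProj h D) := by
  obtain ⟨k, hk⟩ := exists_factor_piProj hnd hNS h hD (𝟙 D)
  have := (isDecidableQuotient_piProj h D).epi
  have : Mono (piProj h D) := mono_of_mono_fac hk
  exact isIso_of_mono_of_epi _

/-- Evaluation at a point of `X` lands in a decidable object, so it factors through the decidable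
quotient of `Z ^ X`. Points separate maps into `Z`, so that quotient map is monic. -/
theorem decidable_expObj (hnd : Nondegenerate C) (hNS : NS C) (h : DQO C) {X : C} {Z : C}
    (hZ : decidableObj C Z) : decidableObj C (expObj X Z) := by
  have hm : Mono (piProj h (expObj X Z)) := ⟨fun {T} u v huv => by
    apply exp_hom_ext
    refine decidable_hom_ext hnd hNS hZ fun x => ?_
    -- Evaluation at the `X`-coordinate of the point `x` of `X ⨯ T`.
    let ev : expObj X Z ⟶ Z :=
      prod.lift (terminal.from _ ≫ x ≫ prod.fst) (𝟙 _) ≫ expEv X Z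
    obtain ⟨k, hk⟩ := exists_factor_piProj hnd hNS h hZ ev
    have key : ∀ w : T ⟶ expObj X Z,
        x ≫ prod.map (𝟙 X) w ≫ expEv X Z = x ≫ prod.snd ≫ w ≫ ev := by
      intro w
      have : x ≫ prod.map (𝟙 X) w = (x ≫ prod.snd ≫ w) ≫
          prod.lift (terminal.from _ ≫ x ≫ prod.fst) (𝟙 _) := by
        ext
        · simp only [Category.assoc, prod.map_fst, prod.lift_fst, Category.comp_id]
          simp only [← Category.assoc]
          rw [Subsingleton.elim (((x ≫ prod.snd) ≫ w) ≫ terminal.from _) (𝟙 _), Category.id_comp]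
        · simp [prod.lift_snd]
      rw [← Category.assoc, this]
      simp only [ev, Category.assoc]
    rw [key, key, ← hk, reassoc_of% huv]⟩
  exact decidable_of_mono hnd hNS (piProj h _) (isDecidableQuotient_piProj h _).decidable

end Quotient

/-! ### Finite limits and exponentials of decidable objects. -/

section DecLimits

variable {C : Type u} [Category.{v} C] [IsTopos C]

theorem decidable_of_jointly_mono (hnd : Nondegenerate C) (hNS : NS C) {X Y Z : C}
    (hY : decidableObj C Y) (hZ : decidableObj C Z) (f : X ⟶ Y) (g : X ⟶ Z)
    (h : ∀ {T : C} (u v : T ⟶ X), u ≫ f = v ≫ f → u ≫ g = v ≫ g → u = v) :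
    decidableObj C X := by
  have : Mono (prod.lift f g) := ⟨fun u v huv => h u v
    (by simpa [prod.lift_fst] using congrArg (· ≫ prod.fst) huv)
    (by simpa [prod.lift_snd] using congrArg (· ≫ prod.snd) huv)⟩
  exact decidable_of_mono hnd hNS (prod.lift f g) (decidable_prod hnd hNS hY hZ)

theorem dec_closedUnderTerminal (hnd : Nondegenerate C) (hNS : NS C) :
    (decidableObj C).IsClosedUnderLimitsOfShape (Discrete.{0} PEmpty) where
  limitsOfShape_le := by
    rintro X ⟨p⟩
    exact decidable_of_subsingleton hnd hNS fun u v => p.isLimit.hom_ext fun j => j.as.elim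

theorem dec_closedUnderPair (hnd : Nondegenerate C) (hNS : NS C) :
    (decidableObj C).IsClosedUnderLimitsOfShape (Discrete WalkingPair) where
  limitsOfShape_le := by
    rintro X ⟨p⟩
    refine decidable_of_jointly_mono hnd hNS (p.prop_diag_obj ⟨.left⟩) (p.prop_diag_obj ⟨.right⟩)
      (p.π.app ⟨.left⟩) (p.π.app ⟨.right⟩) fun u v h₁ h₂ => p.isLimit.hom_ext ?_
    rintro ⟨_ | _⟩
    · exact h₁
    · exact h₂

theorem dec_closedUnderCospan (hnd : Nondegenerate C) (hNS : NS C) :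
    (decidableObj C).IsClosedUnderLimitsOfShape WalkingCospan where
  limitsOfShape_le := by
    rintro X ⟨p⟩
    refine decidable_of_jointly_mono hnd hNS (p.prop_diag_obj .left) (p.prop_diag_obj .right)
      (p.π.app .left) (p.π.app .right) fun u v h₁ h₂ => p.isLimit.hom_ext ?_
    rintro (_ | _ | _)
    · have := p.π.naturality WalkingCospan.Hom.inl
      simp only [Functor.const_obj_obj, Functor.const_obj_map, Category.id_comp] at this
      change u ≫ p.π.app _ = v ≫ p.π.app _
      erw [this, reassoc_of% h₁]
    · exact h₁
    · exact h₂

theorem dec_hasFiniteLimits (hnd : Nondegenerate C) (hNS : NS C) : HasFiniteLimits (Dec C) := by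
  have := dec_closedUnderTerminal hnd hNS
  have := dec_closedUnderCospan hnd hNS
  have : HasTerminal (Dec C) := by infer_instance
  have : HasPullbacks (Dec C) := by infer_instance
  exact hasFiniteLimits_of_hasTerminal_and_pullbacks

theorem dec_preserves_pair (hnd : Nondegenerate C) (hNS : NS C) :
    PreservesLimitsOfShape (Discrete WalkingPair) (decidableObj C).ι := by
  have := dec_closedUnderPair hnd hNS
  infer_instance

theorem dec_preserves_cospan (hnd : Nondegenerate C) (hNS : NS C) :
    PreservesLimitsOfShape WalkingCospan (decidableObj C).ι := by
  have := dec_closedUnderCospan hnd hNS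
  infer_instance

theorem dec_exponentiable (hnd : Nondegenerate C) (hNS : NS C) (h : DQO C)
    [HasFiniteLimits (Dec C)] (D : Dec C) : (prod.functor.obj D).IsLeftAdjoint := by
  have := dec_preserves_pair hnd hNS
  let R : Dec C ⥤ Dec C := (decidableObj C).lift
    ((decidableObj C).ι ⋙ (prod.functor.obj D.obj).rightAdjoint)
    fun Z => decidable_expObj hnd hNS h Z.property
  let comm₁ : (decidableObj C).ι ⋙ prod.functor.obj D.obj ≅
      prod.functor.obj D ⋙ (decidableObj C).ι :=
    (NatIso.ofComponents (fun X => PreservesLimitPair.iso (decidableObj C).ι D X)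
      fun {X Y} f => by
        have h := prodComparison_natural (decidableObj C).ι (𝟙 D) f
        rw [(decidableObj C).ι.map_id] at h
        exact h).symm
  let comm₂ : (decidableObj C).ι ⋙ (prod.functor.obj D.obj).rightAdjoint ≅
      R ⋙ (decidableObj C).ι := Iso.refl _
  exact ((Adjunction.ofIsLeftAdjoint (prod.functor.obj D.obj)).restrictFullyFaithful
    (decidableObj C).fullyFaithfulι (decidableObj C).fullyFaithfulι comm₁ comm₂).isLeftAdjoint

end DecLimits

/-! ### Subobject classifiers and complemented subobjects. -/

section Two

variable {C : Type u} [Category.{v} C] [IsTopos C]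

/-- The decidable truth values form a decidable subobject of the subobject classifier. -/
theorem exists_decidable_truth_values (hnd : Nondegenerate C) (hNS : NS C) :
    ∃ (U : C) (m : U ⟶ HasSubobjectClassifier.Ω C) (t : ⊤_ C ⟶ U), Mono m ∧
      decidableObj C U ∧ t ≫ m = constTrue _ ∧
      ∀ {X : C} (A : Subobject X), IsComplementedSub A → ∃ k : X ⟶ U, k ≫ m = char A := by
  obtain ⟨O, hO⟩ := exists_subobject_without_points hnd hNS (⊤_ C)
  -- `O` has no points, so `char O` is false and `S` is `{true, false}` inside `Ω`. Minimality of
  -- `S` makes its two points codisjoint.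
  obtain ⟨S, hS₁, hS₂, hmin⟩ := exists_joint_image (constTrue (⊤_ C)) (char O)
  let t := S.factorThru _ hS₁
  let f := S.factorThru _ hS₂
  have htf : t ≠ f := by
    intro h
    have h' := congrArg (· ≫ S.arrow) h
    simp only [t, f, Subobject.factorThru_arrow] at h'
    refine hO (𝟙 _) ?_
    rw [factors_iff_char, Category.id_comp, h']
  have hcod : Codisjoint (Subobject.mk t) (Subobject.mk f) := by
    intro D htD hfD
    have ht : D.Factors t := Subobject.factors_of_le _ htD (Subobject.mk_factors_self t)
    have hf : D.Factors f := Subobject.factors_of_le _ hfD (Subobject.mk_factors_self f)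
    have hSB : S ≤ Subobject.mk (D.arrow ≫ S.arrow) := by
      refine hmin _ ?_ ?_
      · rw [mk_factors]
        exact ⟨D.factorThru t ht, by simp [t]⟩
      · rw [mk_factors]
        exact ⟨D.factorThru f hf, by simp [f]⟩
    obtain ⟨k, hk⟩ := (mk_factors _ _).1 (Subobject.factors_of_le _ hSB (Subobject.factors_self S))
    have hk' : k ≫ D.arrow = 𝟙 _ := by
      rw [← cancel_mono S.arrow, Category.assoc, hk, Category.id_comp]
    rw [subobject_eq_top (A := D)]
    rw [← hk']
    exact Subobject.factors_comp_arrow k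
  refine ⟨(S : C), S.arrow, t, inferInstance, ?_, Subobject.factorThru_arrow _ _ _, ?_⟩
  · refine isComplementedSub_of hnd hNS fun D hD hD' => ?_
    have eq : ∀ {T : C} (s : T ⟶ (S : C) ⨯ (S : C)), s ≫ prod.fst = s ≫ prod.snd →
        D.Factors s := fun s hs => Subobject.factors_of_le _ hD ((mk_diag_factors _).2 hs)
    have ne : ∀ {T : C} (s : T ⟶ (S : C) ⨯ (S : C)) (a b : ⊤_ C ⟶ (S : C)), a ≠ b →
        s ≫ prod.fst = terminal.from T ≫ a → s ≫ prod.snd = terminal.from T ≫ b →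
        D.Factors s := by
      intro T s a b hab h₁ h₂
      refine hD' s fun x hx => hab ?_
      rw [mk_diag_factors, Category.assoc, Category.assoc, h₁, h₂, ← Category.assoc,
        ← Category.assoc, Subsingleton.elim (x ≫ terminal.from T) (𝟙 _), Category.id_comp,
        Category.id_comp] at hx
      exact hx
    -- Each coordinate is `t` or `f`: equal pairs lie on the diagonal, and unequal pairs lie off it
    -- because `t ≠ f`.
    refine factors_of_codisjoint hcod D prod.fst (𝟙 _) (fun s hs => ?_) fun s hs => ?_
    all_goals
      rw [mk_point_factors] at hs
      rw [Category.comp_id]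
      refine factors_of_codisjoint hcod D (s ≫ prod.snd) s (fun r hr => ?_) fun r hr => ?_
      all_goals
        rw [mk_point_factors, ← Category.assoc] at hr
    · exact eq _ (by rw [hr, Category.assoc, hs, ← Category.assoc, terminal.comp_from])
    · exact ne _ t f htf (by rw [Category.assoc, hs, ← Category.assoc, terminal.comp_from]) hr
    · exact ne _ f t htf.symm (by rw [Category.assoc, hs, ← Category.assoc, terminal.comp_from]) hr
    · exact eq _ (by rw [hr, Category.assoc, hs, ← Category.assoc, terminal.comp_from])
  · intro X A hA
    have hSA : S.Factors (char A) := by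
      refine hA.cases hnd hNS S (𝟙 X) (char A) (fun s hs => ?_) fun s hs => ?_
      · rw [Category.comp_id, factors_iff_char] at hs
        rw [hs, ← comp_constTrue (terminal.from _)]
        exact factors_precomp hS₁ _
      · rw [Category.comp_id] at hs
        have : s ≫ char A = terminal.from _ ≫ char O := by
          apply char_ext
          intro T r
          rw [← Category.assoc, ← Category.assoc, ← factors_iff_char, ← factors_iff_char]
          constructor
          · intro hr
            refine factors_of_isEmpty_points hNS ⟨fun x => hs (x ≫ r) ?_⟩ _ _
            rw [Category.assoc]
            exact factors_precomp hr x
          · intro hr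
            exact factors_of_isEmpty_points hNS ⟨fun x => hO _ (factors_precomp hr x)⟩ _ _
        rw [this]
        exact factors_precomp hS₂ _
    exact ⟨S.factorThru _ hSA, S.factorThru_arrow _ _⟩

theorem isPullback_point_iff {A X U : C} (m : A ⟶ X) [Mono m] (a : A ⟶ ⊤_ C) (c : X ⟶ U)
    (t : ⊤_ C ⟶ U) : IsPullback m a c t ↔
      ∀ {T : C} (s : T ⟶ X), (Subobject.mk m).Factors s ↔ s ≫ c = terminal.from T ≫ t := by
  constructor
  · intro h T s
    rw [mk_factors]
    constructor
    · rintro ⟨k, rfl⟩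
      rw [Category.assoc, h.w, ← Category.assoc, Subsingleton.elim (k ≫ a)]
    · intro hs
      exact ⟨h.lift _ _ hs, h.lift_fst _ _ _⟩
  · intro h
    refine ⟨⟨by rw [(h m).1 (Subobject.mk_factors_self m), Subsingleton.elim a]⟩, ⟨PullbackCone.isLimitAux' _ fun s => ?_⟩⟩
    have hs : s.fst ≫ c = terminal.from _ ≫ t := by
      rw [s.condition, Subsingleton.elim s.snd]
    have hk := (mk_factors _ _).1 ((h s.fst).2 hs)
    refine ⟨hk.choose, hk.choose_spec, Subsingleton.elim _ _, fun {k} h₁ _ => ?_⟩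
    exact (cancel_mono m).1 (h₁.trans hk.choose_spec.symm)

/-- By `hB`, characteristic maps on decidable objects land in the object of decidable truth values.
Uniqueness is inherited from `Ω`. -/
theorem dec_hasSubobjectClassifier (hnd : Nondegenerate C) (hNS : NS C)
    (hB : ∀ {D : C} (A : Subobject D), decidableObj C D → IsComplementedSub A) :
    HasSubobjectClassifier (Dec C) := by
  have := dec_preserves_cospan hnd hNS
  obtain ⟨U, m, t, hm, hU, ht, hchar⟩ := exists_decidable_truth_values hnd hNS
  have mono : ∀ {X Y : Dec C} (i : X ⟶ Y) [Mono i], Mono i.hom := fun i _ =>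
    inferInstanceAs (Mono ((decidableObj C).ι.map i))
  have htop : decidableObj C (⊤_ C) :=
    decidable_of_subsingleton hnd hNS fun _ _ => Subsingleton.elim _ _
  have hterm : IsTerminal (⟨⊤_ C, htop⟩ : Dec C) :=
    IsTerminal.ofUniqueHom (fun X => ObjectProperty.homMk (terminal.from X.obj))
      fun X f => by
        ext
  have hk : ∀ {X Y : Dec C} (i : X ⟶ Y) [Mono i], ∃ k : Y.obj ⟶ U,
      ∀ {T : C} (s : T ⟶ Y.obj), (∃ l, l ≫ i.hom = s) ↔ s ≫ k = terminal.from T ≫ t := by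
    intro X Y i _
    have := mono i
    obtain ⟨k, hk⟩ := hchar (Subobject.mk i.hom) (hB _ Y.property)
    refine ⟨k, fun s => ?_⟩
    rw [← mk_factors, factors_iff_char, ← hk, ← cancel_mono m, Category.assoc, Category.assoc, ht,
      comp_constTrue]
  choose k hk using @hk
  refine ⟨⟨Subobject.Classifier.mkOfTerminalΩ₀ ⟨⊤_ C, htop⟩ hterm ⟨U, hU⟩ (ObjectProperty.homMk t)
    (fun i _ => ObjectProperty.homMk (k i)) (fun {X Y} i _ => ?_) fun {X Y} i _ c hc => ?_⟩⟩
  · have := mono i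
    have h : IsPullback i.hom (hterm.from X).hom (k i) t :=
      (isPullback_point_iff i.hom _ (k i) t).2 fun s => by rw [mk_factors, hk i]
    exact IsPullback.of_map (decidableObj C).ι (ObjectProperty.hom_ext _ h.w) h
  · have := mono i
    have h : IsPullback i.hom (hterm.from X).hom c.hom t := hc.map (decidableObj C).ι
    rw [isPullback_point_iff] at h
    ext
    change c.hom = k i
    rw [← cancel_mono m]
    apply char_ext
    intro T s
    have key : ∀ w : Y.obj ⟶ U, s ≫ w ≫ m = constTrue T ↔ s ≫ w = terminal.from T ≫ t := by
      intro w
      rw [← cancel_mono m, Category.assoc, Category.assoc, ht, comp_constTrue]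
    rw [key, key, ← h, mk_factors, hk i]

/-- Subobjects of decidable objects are complemented when decidable objects form a topos. -/
theorem isComplementedSub_of_isTopos_dec (hnd : Nondegenerate C) (hNS : NS C)
    (hT : IsTopos (Dec C)) {D : C} (A : Subobject D) (hD : decidableObj C D) :
    IsComplementedSub A := by
  have := dec_preserves_cospan hnd hNS
  let c : Subobject.Classifier (Dec C) := HasSubobjectClassifier.exists_classifier.some
  let D' : Dec C := ⟨D, hD⟩
  let A' : Dec C := ⟨(A : C), decidable_of_mono hnd hNS A.arrow hD⟩
  let i : A' ⟶ D' := ObjectProperty.homMk A.arrow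
  have : Mono i := (decidableObj C).ι.mono_of_mono_map (inferInstanceAs (Mono A.arrow))
  have h := (c.isPullback i).map (decidableObj C).ι
  have hw : c.χ₀ A' = i ≫ c.χ₀ D' := Subsingleton.elim _ _
  -- Pullbacks in `Dec C` are pullbacks in `C`, so `A` is where its characteristic map equals truth,
  -- the inverse image of the complemented diagonal of the classifier.
  refine IsComplementedSub.of_iff hnd hNS c.Ω.property
    (prod.lift (c.χ i).hom ((c.χ₀ D').hom ≫ c.truth.hom)) fun {T} t => ?_
  rw [mk_diag_factors, Category.assoc, Category.assoc, prod.lift_fst, prod.lift_snd]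
  constructor
  · intro ht
    have hw' : A.arrow ≫ (c.χ i).hom = A.arrow ≫ (c.χ₀ D').hom ≫ c.truth.hom := by
      have := (c.isPullback i).w
      rw [hw, Category.assoc] at this
      exact congrArg (fun g => g.hom) this
    rw [← A.factorThru_arrow t ht, Category.assoc, hw', Category.assoc]
  · intro ht
    rw [← Category.assoc t] at ht
    have := h.lift_fst t (t ≫ (c.χ₀ D').hom) ht
    change _ ≫ A.arrow = t at this
    rw [← this]
    exact Subobject.factors_comp_arrow _

end Two

/-! ### Dense arrows and the two implications. -/

section Dense

variable {C : Type u} [Category.{v} C] [IsTopos C]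

/-- A point outside `A` is disjoint from `A`, hence lies in `¬A`, which has no points when `¬¬A` is
everything. -/
theorem IsDenseSub.factors_point (hnd : Nondegenerate C) (hNS : NS C) {X : C} {A : Subobject X}
    (hA : IsDenseSub A) (x : ⊤_ C ⟶ X) : A.Factors x := by
  obtain ⟨N, hN, hN'⟩ := hA
  have hbot := (hN' ⊤).1 le_rfl
  rw [top_inf_eq, isBot_iff hnd hNS] at hbot
  by_contra hx
  have hle : Subobject.mk x ≤ N := by
    rw [hN, isBot_iff hnd hNS]
    intro y hy
    rw [Subobject.inf_factors, mk_point_factors, Subsingleton.elim (terminal.from _) (𝟙 _),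
      Category.id_comp] at hy
    exact hx (hy.1 ▸ hy.2)
  exact hbot x (Subobject.factors_of_le _ hle (Subobject.mk_factors_self x))

theorem isDenseSub_of_points (hnd : Nondegenerate C) (hNS : NS C) {X : C} {A : Subobject X}
    (hA : ∀ x : ⊤_ C ⟶ X, A.Factors x) : IsDenseSub A := by
  obtain ⟨O, hO⟩ := exists_subobject_without_points hnd hNS X
  refine ⟨O, fun B => ?_, fun B => ?_⟩
  · rw [isBot_iff hnd hNS]
    constructor
    · intro hB x hx
      exact hO x (Subobject.factors_of_le _ hB ((Subobject.inf_factors _).1 hx).1)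
    · intro hB
      exact (isBot_iff hnd hNS B).2
        (fun x hx => hB x ((Subobject.inf_factors _).2 ⟨hx, hA x⟩)) O
  · rw [isBot_iff hnd hNS]
    exact ⟨fun _ x hx => hO x ((Subobject.inf_factors _).1 hx).2, fun _ => le_top⟩

theorem isDenseArrow_arrow {X : C} {A : Subobject X} (hA : IsDenseSub A) :
    IsDenseArrow A.arrow :=
  ⟨A, ⟨Subobject.factors_self A, fun _ => Subobject.le_of_factors⟩, hA⟩

theorem epi_piMap_of_isTopos_dec (hnd : Nondegenerate C) (hNS : NS C) (h : DQO C)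
    (hT : IsTopos (Dec C)) {X Y : C} (f : X ⟶ Y) (hf : IsDenseArrow f)
    (g : Pi h X ⟶ Pi h Y) (hg : IsPiMap h f g) : Epi g := by
  obtain ⟨A, ⟨-, hmin⟩, hA⟩ := hf
  refine ⟨fun {Z} a b hab => ?_⟩
  have hY := isDecidableQuotient_piProj h Y
  have := hY.epi
  have hE := isComplementedSub_of_isTopos_dec hnd hNS hT (Subobject.mk (equalizer.ι a b))
    hY.decidable
  have hAE : A ≤ (Subobject.pullback (piProj h Y)).obj (Subobject.mk (equalizer.ι a b)) := by
    apply hmin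
    rw [pullback_factors, mk_equalizer_factors, ← hg, Category.assoc, Category.assoc, hab]
  -- A complemented equalizer need only be checked at points. Each lifts to a point of `Y`, which
  -- the dense image contains.
  have h1 : (Subobject.mk (equalizer.ι a b)).Factors (𝟙 (Pi h Y)) := by
    refine hE.factors_of_points hnd hNS _ fun q => ?_
    obtain ⟨y, rfl⟩ := exists_point_lift hnd hNS (piProj h Y) hY.decidable q
    rw [Category.comp_id, ← pullback_factors]
    exact Subobject.factors_of_le _ hAE (hA.factors_point hnd hNS y)
  rw [mk_equalizer_factors, Category.id_comp, Category.id_comp] at h1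
  exact h1

theorem isComplementedSub_of_epi_piMap (hnd : Nondegenerate C) (hNS : NS C) (h : DQO C)
    (hepi : ∀ {X Y : C} (f : X ⟶ Y), IsDenseArrow f → ∀ g : Pi h X ⟶ Pi h Y, IsPiMap h f g → Epi g)
    {D : C} (A : Subobject D) (hD : decidableObj C D) : IsComplementedSub A := by
  refine isComplementedSub_of hnd hNS fun B hAB hB => ?_
  -- Excluded middle holds for a single point, so `B`, lying above `A` and `¬A`, contains every
  -- point.
  have hpts : ∀ x : ⊤_ C ⟶ D, B.Factors x := by
    intro x
    by_cases hx : A.Factors x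
    · exact Subobject.factors_of_le _ hAB hx
    · refine hB x fun y => ?_
      rwa [Subsingleton.elim y (𝟙 _), Category.id_comp]
  have hdense := isDenseArrow_arrow (isDenseSub_of_points hnd hNS hpts)
  obtain ⟨g, hg, -⟩ := existsUnique_piMap hnd hNS h B.arrow
  have := hepi _ hdense g hg
  have := (isDecidableQuotient_piProj h (B : C)).epi
  have := isIso_piProj hnd hNS h hD
  -- As `p_D` is invertible, the inclusion of `B` is a composite of epimorphisms; being also monic,
  -- it is invertible.
  have hcomp : (piProj h (B : C) ≫ g) ≫ inv (piProj h D) = B.arrow := by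
    rw [IsIso.comp_inv_eq]
    exact hg
  have : Epi B.arrow := by
    rw [← hcomp]
    infer_instance
  have : IsIso B.arrow := isIso_of_mono_of_epi _
  rw [Subobject.eq_top_of_isIso_arrow B]
  exact Subobject.top_factors _

theorem isTopos_dec (hnd : Nondegenerate C) (hNS : NS C) (h : DQO C)
    (hB : ∀ {D : C} (A : Subobject D), decidableObj C D → IsComplementedSub A) :
    IsTopos (Dec C) :=
  have := dec_hasFiniteLimits hnd hNS
  { toHasSubobjectClassifier := dec_hasSubobjectClassifier hnd hNS hB
    exponentiable := dec_exponentiable hnd hNS h }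

end Dense

end DecQuot

theorem corollaryT {E : Type u} [Category.{v} E] [DecQuot.IsTopos E]
    (hnd : DecQuot.Nondegenerate E) (hNS : DecQuot.NS E) (hDQO : DecQuot.DQO E) :
    (∀ {X Y : E} (f : X ⟶ Y), ∃! g : DecQuot.Pi hDQO X ⟶ DecQuot.Pi hDQO Y,
      DecQuot.IsPiMap hDQO f g) ∧
    (DecQuot.IsTopos (DecQuot.Dec E) ↔
      ∀ {X Y : E} (f : X ⟶ Y), DecQuot.IsDenseArrow f →
        ∀ g : DecQuot.Pi hDQO X ⟶ DecQuot.Pi hDQO Y, DecQuot.IsPiMap hDQO f g → Epi g) :=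
  ⟨fun f => DecQuot.existsUnique_piMap hnd hNS hDQO f,
    fun hT _ _ f hf g hg => DecQuot.epi_piMap_of_isTopos_dec hnd hNS hDQO hT f hf g hg,
    fun hepi => DecQuot.isTopos_dec hnd hNS hDQO
      (DecQuot.isComplementedSub_of_epi_piMap hnd hNS hDQO hepi)⟩
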